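/- Let $\Gamma$ be a discrete group with a finite generating set $S$ and the (left-invariant) word metric $d_S(g,h)=|g^{-1}h|_S$. Suppose that $\Gamma$ has a finite CW complex $B\Gamma$ as classifying space, i.e. $B\Gamma$ is a finite CW complex with contractible universal cover $q:E\Gamma\to B\Gamma$ on which $\Gamma$ acts as the group of deck transformations. Let $B\Gamma$ carry a geodesic metric inducing its topology, and give $E\Gamma$ the lifted metric: the distance between $x$ and $y$ is the infimum of the lengths in $B\Gamma$ of the images $q\circ\sigma$ of paths $\sigma$ from $x$ to $y$ in $E\Gamma$. Let $P$ be a finite-dimensional simplicial complex with a simplicial action of $\Gamma$, and let $\alpha:\Gamma\times P\to\mathbb R^n$ be a map such that 1. $\alpha$ is invariant under the diagonal action: $\alpha(\gamma g,\gamma p)=\alpha(g,p)$ for all $\gamma,g\in\Gamma$, $p\in P$; 2. the restriction $\alpha|_{g\times P}$ is continuous and proper for every $g\in\Gamma$; 3. the restriction $\alpha|_{\Gamma\times p}$ is $1$-Lipschitz with respect to $d_S$ for every $p\in P$. Let $x_0\in E\Gamma$, and identify $\Gamma$ with the orbit $\Gamma x_0$. Then, up to a rescaling of $\mathbb R^n$,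 $\alpha$ extends to $E\Gamma\times P$ with the same properties: there are a constant $c>0$ and a continuous map $\bar\alpha:E\Gamma\times P\to\mathbb R^n$ with $\bar\alpha(\gamma x_0,p)=c\,\alpha(\gamma,p)$ for all $\gamma\in\Gamma$, $p\in P$, such that 1. $\bar\alpha$ is invariant under the diagonal action of $\Gamma$ on $E\Gamma\times P$; 2. the restriction $\bar\alpha|_{y\times P}$ is proper for every $y\in E\Gamma$; 3. the restriction $\bar\alpha|_{E\Gamma\times p}$ is $1$-Lipschitz with respect to the lifted metric for every $p\in P$ (here $\mathbb R^n$ has the Euclidean metric). -/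

import Mathlib

noncomputable section

open scoped ENNReal

/-! ### Word metric -/

/-- The word length of `g` with respect to `S`: the least length of a word in the letters
`S ∪ S⁻¹` that represents `g`. -/
def wordLength {Γ : Type*} [Group Γ] (S : Finset Γ) (g : Γ) : ℕ :=
  sInf {m : ℕ | ∃ l : List Γ, (∀ a ∈ l, a ∈ S ∨ a⁻¹ ∈ S) ∧ l.prod = g ∧ l.length = m}

/-- The (left-invariant) word metric `d_S(g, h) = |g⁻¹ h|_S`. -/
def wordDist {Γ : Type*} [Group Γ] (S : Finset Γ) (g h : Γ) : ℕ :=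
  wordLength S (g⁻¹ * h)

/-! ### Geodesic metrics and the lifted metric -/

/-- Any two points are joined by a geodesic segment, i.e. by an isometrically embedded interval
of length `dist x y`. -/
def IsGeodesicSpace (B : Type*) [MetricSpace B] : Prop :=
  ∀ x y : B, ∃ c : ℝ → B, c 0 = x ∧ c (dist x y) = y ∧
    ∀ s ∈ Set.Icc (0 : ℝ) (dist x y), ∀ t ∈ Set.Icc (0 : ℝ) (dist x y),
      dist (c s) (c t) = |s - t|

/-- The metric on `E` lifted from the metric of `B` along `q : E → B`: the distance from `x` to
`y` is the infimum of the lengths, measured in `B`, of the images of the paths from `x` to `y`. -/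
def liftedEDist {E B : Type*} [TopologicalSpace E] [MetricSpace B] (q : E → B) (x y : E) : ℝ≥0∞ :=
  ⨅ σ : Path x y, eVariationOn (fun t : unitInterval => q (σ t)) Set.univ

/-! ### Geometric realizations of simplicial complexes -/

/-- The geometric realization of an abstract simplicial complex: the barycentric coordinate
functions (nonnegative, with sum `1`) whose support is a simplex. -/
def Realization {V : Type*} (K : AbstractSimplicialComplex V) : Type _ :=
  {x : V →₀ ℝ // x.support ∈ K ∧ (∀ v, 0 ≤ x v) ∧ (x.sum fun _ t => t) = 1}

/-- The closed simplex of the realization spanned by the vertices in `s`. -/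
def closedSimplex {V : Type*} (K : AbstractSimplicialComplex V) (s : Finset V) : Type _ :=
  {x : Realization K // x.1.support ⊆ s}

/-- A closed simplex has the Euclidean topology of its barycentric coordinates. -/
instance {V : Type*} (K : AbstractSimplicialComplex V) (s : Finset V) :
    TopologicalSpace (closedSimplex K s) :=
  TopologicalSpace.induced (fun x (v : V) => x.1.1 v) inferInstance

/-- The weak topology: a set is open if and only if its trace on every closed simplex is open. -/
instance {V : Type*} (K : AbstractSimplicialComplex V) : TopologicalSpace (Realization K) :=
  ⨆ s : {s : Finset V // s ∈ K},
    TopologicalSpace.coinduced (fun x : closedSimplex K s.1 => x.1) inferInstance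

/-- A simplicial complex is finite dimensional if the dimensions of its simplices are bounded. -/
def IsFiniteDimensionalComplex {V : Type*} (K : AbstractSimplicialComplex V) : Prop :=
  ∃ d : ℕ, ∀ s ∈ K, s.card ≤ d + 1

/-- The group `Γ` acts on `K` by simplicial automorphisms: it acts on the vertices and maps
simplices to simplices. -/
class SimplicialAction (Γ : Type*) [Group Γ] {V : Type*} [MulAction Γ V]
    (K : AbstractSimplicialComplex V) : Prop where
  map_mem : ∀ (γ : Γ) (s : Finset V), s ∈ K → s.map (MulAction.toPerm γ).toEmbedding ∈ K

/-- The induced action on the realization, linear on each simplex: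
`γ • ∑ tᵥ v = ∑ tᵥ (γ • v)`. -/
instance {Γ : Type*} [Group Γ] {V : Type*} [MulAction Γ V] (K : AbstractSimplicialComplex V)
    [SimplicialAction Γ K] : MulAction Γ (Realization K) where
  smul γ x := ⟨Finsupp.equivMapDomain (MulAction.toPerm γ) x.1,
    SimplicialAction.map_mem γ _ x.2.1, fun v => x.2.2.1 _, by
      rw [Finsupp.equivMapDomain_eq_mapDomain, Finsupp.sum_mapDomain_index (by simp) (by simp)]
      exact x.2.2.2⟩
  one_smul x := Subtype.ext (Finsupp.ext fun v => by
    change x.1 ((1 : Γ)⁻¹ • v) = x.1 v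
    simp)
  mul_smul a b x := Subtype.ext (Finsupp.ext fun v => by
    change x.1 ((a * b)⁻¹ • v) = x.1 (b⁻¹ • a⁻¹ • v)
    simp [mul_smul])

/-! ### The conditions on maps `X × P → ℝⁿ` -/

/-- Invariance with respect to the diagonal action of `Γ` on `X × P`. -/
def IsDiagonallyInvariant (Γ : Type*) [Group Γ] {X P Z : Type*} [MulAction Γ X] [MulAction Γ P]
    (f : X × P → Z) : Prop :=
  ∀ (γ : Γ) (x : X) (p : P), f (γ • x, γ • p) = f (x, p)

/-- The restriction to each slice `{x} × P` is a proper (in particular, continuous) map. -/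
def IsProperOnSlices {X P Z : Type*} [TopologicalSpace P] [TopologicalSpace Z]
    (f : X × P → Z) : Prop :=
  ∀ x : X, IsProperMap fun p : P => f (x, p)

end

section

open Filter Topology Set Metric

/-! ### Locally Lipschitz functions and partitions of unity -/

/-! Over small balls of the base the covering splits into sheets labelled by `Γ`. Averaging the
slices of `α` at these labels with a locally Lipschitz partition of unity on the base gives an
invariant map `A` (`IsQuotientCoveringMap.exists_local_combination`). Since the weights sum to `1`,
differences of values of `A` involve `α` only through `α (k, p) - α (1, p)`, which the word metric
bounds uniformly in `p`. This makes every slice of `A` proper, as a bounded perturbation of `α (1,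
·)`, and makes `A` locally Lipschitz over the base. Invariance and compactness of the base make the
constant uniform (`IsQuotientCoveringMap.exists_uniform_of_locally`), subdividing paths passes to
the lifted metric, and dividing by the constant finishes. -/

theorem LocallyLipschitz.comp_contDiffAt {X : Type*} [PseudoMetricSpace X]
    {F G : Type*} [NormedAddCommGroup F] [NormedSpace ℝ F] [NormedAddCommGroup G]
    [NormedSpace ℝ G] {f : X → F} (hf : LocallyLipschitz f) {φ : F → G}
    (hφ : ∀ x, ContDiffAt ℝ 1 φ (f x)) : LocallyLipschitz fun x => φ (f x) := by
  intro x
  obtain ⟨K, t, ht, hK⟩ := (hφ x).exists_lipschitzOnWith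
  obtain ⟨L, s, hs, hL⟩ := hf x
  refine ⟨K * L, s ∩ f ⁻¹' t, inter_mem hs (hf.continuous.continuousAt ht), ?_⟩
  exact hK.comp (hL.mono inter_subset_left) fun y hy => hy.2

theorem LocallyLipschitz.finset_sum {X ι G : Type*} [PseudoMetricSpace X]
    [SeminormedAddCommGroup G] (t : Finset ι) {f : ι → X → G}
    (hf : ∀ i ∈ t, LocallyLipschitz (f i)) : LocallyLipschitz fun x => ∑ i ∈ t, f i x := by
  classical
  induction t using Finset.induction_on with
  | empty => simpa using LocallyLipschitz.const (0 : G)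
  | insert a t ha ih =>
    simp only [Finset.sum_insert ha]
    exact (hf a (by simp)).add (ih fun i hi => hf i (by simp [hi]))

theorem LocallyLipschitz.mul_real {X : Type*} [PseudoMetricSpace X] {f g : X → ℝ}
    (hf : LocallyLipschitz f) (hg : LocallyLipschitz g) :
    LocallyLipschitz fun x => f x * g x :=
  (hf.prodMk hg).comp_contDiffAt (φ := fun z : ℝ × ℝ => z.1 * z.2) fun _ => by fun_prop

theorem LocallyLipschitz.div_real {X : Type*} [PseudoMetricSpace X] {f g : X → ℝ}
    (hf : LocallyLipschitz f) (hg : LocallyLipschitz g) (h0 : ∀ x, g x ≠ 0) :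
    LocallyLipschitz fun x => f x / g x :=
  (hf.prodMk hg).comp_contDiffAt (φ := fun z : ℝ × ℝ => z.1 / z.2) fun x =>
    contDiffAt_fst.div contDiffAt_snd (h0 x)

/-- On a compact metric space there is a locally Lipschitz partition of unity subordinate to a
given family of balls, all of whose functions but one vanish at a given point. -/
theorem exists_locallyLipschitz_partition {B : Type*} [MetricSpace B] [CompactSpace B] (b₀ : B)
    (r : B → ℝ) (hr : ∀ b, 0 < r b) :
    ∃ (t : Finset B) (φ : B → B → ℝ), b₀ ∈ t ∧ (∀ b, LocallyLipschitz (φ b)) ∧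
      (∀ b y, 0 ≤ φ b y) ∧ (∀ y, ∑ b ∈ t, φ b y = 1) ∧
      (∀ b y, r b ≤ dist y b → φ b y = 0) ∧ ∀ b, b ≠ b₀ → φ b b₀ = 0 := by
  classical
  obtain ⟨t₀, -, ht₀⟩ := isCompact_univ.elim_nhds_subcover (fun b : B => ball b (r b))
    fun b _ => ball_mem_nhds b (hr b)
  -- A tent function on each ball; the second factor kills all but the tent of `b₀` at `b₀`. Hence
  -- `b₀` has to be added to the index set of the cover.
  let ρ : B → B → ℝ := fun b y => max 0 (r b - dist y b) * if b = b₀ then 1 else dist y b₀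
  have hdist (b : B) : LocallyLipschitz fun y : B => dist y b :=
    (LipschitzWith.dist_left b).locallyLipschitz
  have hρL (b : B) : LocallyLipschitz (ρ b) := by
    refine LocallyLipschitz.mul_real
      (((LocallyLipschitz.const (r b)).sub (hdist b)).const_max 0) ?_
    by_cases h : b = b₀
    · simpa [h] using LocallyLipschitz.const (1 : ℝ)
    · simpa [h] using hdist b₀
  have hρ0 (b y : B) : 0 ≤ ρ b y := by
    refine mul_nonneg (le_max_left _ _) ?_
    split_ifs <;> positivity
  let R : B → ℝ := fun y => ∑ b ∈ insert b₀ t₀, ρ b y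
  have hR (y : B) : 0 < R y := by
    suffices h : ∃ b ∈ insert b₀ t₀, 0 < ρ b y from
      Finset.sum_pos' (fun b _ => hρ0 b y) h
    by_cases hy : y = b₀
    · exact ⟨b₀, by simp, by simp [ρ, hy, hr]⟩
    · obtain ⟨b, hb, hyb⟩ := mem_iUnion₂.1 (ht₀ (mem_univ y))
      refine ⟨b, by simp [hb], mul_pos (lt_max_of_lt_right (sub_pos.2 hyb)) ?_⟩
      split_ifs
      · exact one_pos
      · exact dist_pos.2 hy
  refine ⟨insert b₀ t₀, fun b y => ρ b y / R y, by simp, fun b => ?_, fun b y => ?_, fun y => ?_,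
    fun b y h => ?_, fun b hb => ?_⟩
  · exact (hρL b).div_real (LocallyLipschitz.finset_sum _ fun b _ => hρL b) fun y => (hR y).ne'
  · exact div_nonneg (hρ0 b y) (hR y).le
  · rw [← Finset.sum_div]
    exact div_self (hR y).ne'
  · have : max 0 (r b - dist y b) = 0 := max_eq_left (by linarith)
    simp [ρ, this]
  · simp [ρ, hb]

/-! ### The lifted metric and sheets of a covering -/

/-- By compactness of the interval, a fine subdivision puts consecutive points in a common `W t`;
then the triangle inequality applies. -/
theorem edist_le_eVariationOn_of_locally {X Y : Type*} [PseudoEMetricSpace X]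
    [PseudoEMetricSpace Y] {u : unitInterval → X} {v : unitInterval → Y}
    (h : ∀ t, ∃ W ∈ 𝓝 t, ∀ a ∈ W, ∀ b ∈ W, edist (u a) (u b) ≤ edist (v a) (v b)) :
    edist (u 0) (u 1) ≤ eVariationOn v univ := by
  choose W hW hWle using h
  obtain ⟨t, ht0, htm, ⟨n, hn⟩, ht⟩ := exists_monotone_Icc_subset_open_cover_unitInterval
    (c := fun i => interior (W i)) (fun _ => isOpen_interior)
    (fun x _ => mem_iUnion.2 ⟨x, mem_interior_iff_mem_nhds.2 (hW x)⟩)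
  calc edist (u 0) (u 1) = edist (u (t 0)) (u (t n)) := by rw [ht0, hn n le_rfl]
    _ ≤ ∑ i ∈ Finset.range n, edist (u (t i)) (u (t (i + 1))) :=
      edist_le_range_sum_edist (fun i => u (t i)) n
    _ ≤ ∑ i ∈ Finset.range n, edist (v (t (i + 1))) (v (t i)) := by
      refine Finset.sum_le_sum fun i _ => ?_
      obtain ⟨j, hj⟩ := ht i
      rw [edist_comm (v _)]
      have hle : t i ≤ t (i + 1) := htm (Nat.le_succ i)
      exact hWle j _ (interior_subset (hj (left_mem_Icc.2 hle))) _
        (interior_subset (hj (right_mem_Icc.2 hle)))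
    _ ≤ eVariationOn v univ := eVariationOn.sum_le htm fun _ => mem_univ _

/-- A map that is locally `1`-Lipschitz with respect to the distance in the base is `1`-Lipschitz
with respect to the lifted metric. -/
theorem edist_le_liftedEDist_of_locally {E B X : Type*} [TopologicalSpace E] [MetricSpace B]
    [PseudoEMetricSpace X] {q : E → B} {f : E → X}
    (h : ∀ x, ∃ W ∈ 𝓝 x, ∀ y ∈ W, ∀ z ∈ W, edist (f y) (f z) ≤ edist (q y) (q z)) (x y : E) :
    edist (f x) (f y) ≤ liftedEDist q x y := by
  refine le_iInf fun σ => ?_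
  have := edist_le_eVariationOn_of_locally (u := fun t => f (σ t)) (v := fun t => q (σ t))
    fun t => by
      obtain ⟨W, hW, hle⟩ := h (σ t)
      exact ⟨σ ⁻¹' W, σ.continuous.continuousAt hW, fun a ha b hb => hle _ ha _ hb⟩
  simpa using this

/-- Over a small ball around `q x`, the points of a regular covering are labelled, equivariantly
and locally constantly, by the deck transformations. -/
theorem IsQuotientCoveringMap.exists_sheet_label {Γ E B : Type*} [Group Γ] [TopologicalSpace E]
    [MetricSpace B] [MulAction Γ E] {q : E → B} (hq : IsQuotientCoveringMap q Γ) (x : E) :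
    ∃ (r : ℝ) (g : E → Γ), 0 < r ∧ g x = 1 ∧ ∀ y, dist (q y) (q x) < r →
      (∀ γ : Γ, g (γ • y) = γ * g y) ∧ ∀ᶠ z in 𝓝 y, g z = g y := by
  classical
  have := hq.toContinuousConstSMul
  obtain ⟨U', hU', hdis'⟩ := hq.disjoint x
  obtain ⟨U, hUU', hU, hxU⟩ := mem_nhds_iff.1 hU'
  -- Distinct translates of `U` are disjoint, so a point lies in at most one sheet.
  have huniq {y : E} {a b : Γ} (ha : a⁻¹ • y ∈ U) (hb : b⁻¹ • y ∈ U) : a = b := by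
    have := hdis' (b⁻¹ * a) ⟨b⁻¹ • y, ⟨a⁻¹ • y, hUU' ha, by simp [mul_smul]⟩, hUU' hb⟩
    exact (inv_mul_eq_one.1 this).symm
  obtain ⟨r, hr, hball⟩ := Metric.isOpen_iff.1 (hq.isOpenQuotientMap.isOpenMap U hU) (q x)
    ⟨x, hxU, rfl⟩
  let g : E → Γ := fun y => if h : ∃ a : Γ, a⁻¹ • y ∈ U then h.choose else 1
  have hg {y : E} {a : Γ} (ha : a⁻¹ • y ∈ U) : g y = a := by
    have h : ∃ a : Γ, a⁻¹ • y ∈ U := ⟨a, ha⟩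
    simp only [g, dif_pos h]
    exact huniq h.choose_spec ha
  refine ⟨r, g, hr, hg (by simpa using hxU), fun y hy => ?_⟩
  obtain ⟨u, hu, huy⟩ := hball hy
  obtain ⟨a, rfl⟩ := hq.apply_eq_iff_mem_orbit.1 huy.symm
  have ha : a⁻¹ • a • u ∈ U := by simpa using hu
  refine ⟨fun γ => ?_, ?_⟩
  · rw [hg ha]
    exact hg (by simpa [mul_smul] using hu)
  · filter_upwards [(continuous_const_smul (a⁻¹ : Γ)).continuousAt.preimage_mem_nhds
      (hU.mem_nhds ha)] with z hz
    rw [hg ha, hg hz]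

/-- A map which is invariant up to deck transformations and locally Lipschitz with respect to the
distance in a compact base is uniformly so. -/
theorem IsQuotientCoveringMap.exists_uniform_of_locally {Γ E B I X : Type*} [Group Γ]
    [TopologicalSpace E] [MetricSpace B] [CompactSpace B] [MulAction Γ E] [MulAction Γ I]
    [PseudoMetricSpace X] {q : E → B} (hq : IsQuotientCoveringMap q Γ) {f : E × I → X}
    (hf : IsDiagonallyInvariant Γ f)
    (h : ∀ x, ∃ C : ℝ, ∃ W ∈ 𝓝 x, ∀ y ∈ W, ∀ z ∈ W, ∀ p,
      dist (f (y, p)) (f (z, p)) ≤ C * dist (q y) (q z)) :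
    ∃ C : ℝ, 0 < C ∧ ∀ x, ∃ W ∈ 𝓝 x, ∀ y ∈ W, ∀ z ∈ W, ∀ p,
      dist (f (y, p)) (f (z, p)) ≤ C * dist (q y) (q z) := by
  have := hq.toContinuousConstSMul
  replace h (x : E) : ∃ C : ℝ, ∃ W : Set E, IsOpen W ∧ x ∈ W ∧ ∀ y ∈ W, ∀ z ∈ W, ∀ p,
      dist (f (y, p)) (f (z, p)) ≤ C * dist (q y) (q z) := by
    obtain ⟨C, W', hW', hle⟩ := h x
    obtain ⟨W, hWW', hW, hx⟩ := mem_nhds_iff.1 hW'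
    exact ⟨C, W, hW, hx, fun y hy z hz => hle y (hWW' hy) z (hWW' hz)⟩
  choose C W hW hxW hle using h
  have hs := hq.surjective
  obtain ⟨t, -, ht⟩ := isCompact_univ.elim_nhds_subcover
    (fun b : B => q '' W (Function.surjInv hs b)) fun b _ => by
      have := hq.isOpenQuotientMap.isOpenMap.image_mem_nhds
        ((hW _).mem_nhds (hxW (Function.surjInv hs b)))
      rwa [Function.surjInv_eq hs] at this
  have hC0 : 0 ≤ ∑ b ∈ t, |C (Function.surjInv hs b)| :=
    Finset.sum_nonneg fun _ _ => abs_nonneg _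
  -- The sum dominates each local constant; the `1` only ensures positivity.
  refine ⟨∑ b ∈ t, |C (Function.surjInv hs b)| + 1, by linarith, fun x => ?_⟩
  obtain ⟨b, hb, w, hw, hwx⟩ := mem_iUnion₂.1 (ht (mem_univ (q x)))
  obtain ⟨γ, rfl⟩ := hq.apply_eq_iff_mem_orbit.1 hwx
  have hq' (y : E) : q (γ • y) = q y := hq.apply_eq_iff_mem_orbit.2 ⟨γ, rfl⟩
  refine ⟨(γ • ·) ⁻¹' W (Function.surjInv hs b),
    (continuous_const_smul γ).continuousAt.preimage_mem_nhds ((hW _).mem_nhds hw), fun y hy z hz p => ?_⟩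
  rw [← hf γ y p, ← hf γ z p]
  refine (hle _ _ hy _ hz _).trans ?_
  rw [hq', hq']
  refine mul_le_mul_of_nonneg_right ?_ dist_nonneg
  have := Finset.single_le_sum (f := fun b => |C (Function.surjInv hs b)|)
    (fun _ _ => abs_nonneg _) hb
  have := le_abs_self (C (Function.surjInv hs b))
  linarith

theorem Topology.CWComplex.compactSpace_of_finite {B : Type*} [TopologicalSpace B]
    [CWComplex (univ : Set B)] [CWComplex.Finite (univ : Set B)] : CompactSpace B := by
  have : _root_.Finite (Σ n, RelCWComplex.cell (univ : Set B) n) :=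
    RelCWComplex.finite_cells_of_finite
  have h : (univ : Set B) = ⋃ e : Σ n, RelCWComplex.cell (univ : Set B) n,
      RelCWComplex.closedCell e.1 e.2 := by
    exact (CWComplex.union (C := (univ : Set B))).symm.trans
      (iUnion_sigma fun e : Σ n, RelCWComplex.cell (univ : Set B) n =>
      RelCWComplex.closedCell e.1 e.2).symm
  exact ⟨h ▸ isCompact_iUnion fun e => RelCWComplex.isCompact_closedCell⟩

/-! ### Extending equivariant maps -/

/-- A continuous map at bounded distance from a proper map to a proper space is proper. -/
theorem IsProperMap.of_dist_le {X Y : Type*} [TopologicalSpace X] [MetricSpace Y]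
    [ProperSpace Y] {f g : X → Y} (hf : IsProperMap f) (hg : Continuous g) {C : ℝ}
    (h : ∀ x, dist (g x) (f x) ≤ C) : IsProperMap g := by
  refine isProperMap_iff_isCompact_preimage.2 ⟨hg, fun K hK => ?_⟩
  -- The `g`-preimage of `K` is closed and lies in the `f`-preimage of the closed `C`-thickening of
  -- `K`.
  refine (hf.isCompact_preimage (hK.isBounded.cthickening (δ := C)).isCompact_closure
    ).of_isClosed_subset (hK.isClosed.preimage hg) fun x hx => subset_closure ?_
  exact mem_cthickening_of_dist_le _ (g x) _ _ hx (by rw [dist_comm]; exact h x)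

/-- Let `Γ` act by deck transformations on a regular covering `E` of a compact metric space. An
invariant map on `Γ × I` with values in a normed space extends to an invariant map on `E × I` that,
locally in `E`, is a combination of finitely many slices of the given map, with locally Lipschitz
coefficients that sum up to `1`. -/
theorem IsQuotientCoveringMap.exists_local_combination {Γ E B I F : Type*} [Group Γ]
    [TopologicalSpace E] [MetricSpace B] [CompactSpace B] [MulAction Γ E] [MulAction Γ I]
    [NormedAddCommGroup F] [NormedSpace ℝ F] {q : E → B} (hq : IsQuotientCoveringMap q Γ)
    {α : Γ × I → F} (hα : IsDiagonallyInvariant Γ α) (x₀ : E) :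
    ∃ (t : Finset B) (φ : B → B → ℝ) (A : E × I → F), (∀ b, LocallyLipschitz (φ b)) ∧
      (∀ b y, 0 ≤ φ b y) ∧ (∀ y, ∑ b ∈ t, φ b y = 1) ∧ IsDiagonallyInvariant Γ A ∧
      (∀ g p, A (g • x₀, p) = α (g, p)) ∧
      ∀ x, ∃ k : B → Γ, ∀ᶠ y in 𝓝 x, ∀ p, A (y, p) = ∑ b ∈ t, φ b (q y) • α (k b, p) := by
  classical
  have hqc : Continuous q := hq.continuous
  have hs := hq.surjective
  -- The set-theoretic section is chosen through `x₀`, so that `x₀` gets the label `1`.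
  let s : B → E := Function.update (Function.surjInv hs) (q x₀) x₀
  have hs₀ : s (q x₀) = x₀ := Function.update_self ..
  have hqs (b : B) : q (s b) = b := by
    by_cases hb : b = q x₀
    · rw [hb, hs₀]
    · simp only [s, Function.update_of_ne hb, Function.surjInv_eq hs]
  choose r g hr hg1 hg using fun b => hq.exists_sheet_label (s b)
  simp only [hqs] at hg
  -- Half the radius leaves a margin: wherever a label may jump, its weight vanishes on a whole
  -- neighbourhood.
  obtain ⟨t, φ, ht₀, hφL, hφ0, hφ1, hφr, hφ₀⟩ := exists_locallyLipschitz_partition (q x₀)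
    (fun b => r b / 2) fun b => half_pos (hr b)
  have hq' (γ : Γ) (y : E) : q (γ • y) = q y := hq.apply_eq_iff_mem_orbit.2 ⟨γ, rfl⟩
  refine ⟨t, φ, fun z => ∑ b ∈ t, φ b (q z.1) • α (g b z.1, z.2), hφL, hφ0, hφ1,
    fun γ y p => ?_, fun γ p => ?_, fun x => ⟨fun b => g b x, ?_⟩⟩
  · refine Finset.sum_congr rfl fun b _ => ?_
    simp only [hq']
    by_cases hb : dist (q y) b < r b
    · rw [(hg b y hb).1, ← smul_eq_mul, hα]
    · rw [hφr b (q y) (by linarith [hr b]), zero_smul, zero_smul]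
  · have hx₀ : dist (q x₀) (q x₀) < r (q x₀) := by simpa using hr _
    have h1 := hφ1 (q x₀)
    rw [Finset.sum_eq_single_of_mem _ ht₀ fun b _ hb => hφ₀ b hb] at h1
    simp only [hq']
    rw [Finset.sum_eq_single_of_mem _ ht₀ fun b _ hb => by rw [hφ₀ b hb, zero_smul], h1, one_smul,
      (hg _ x₀ hx₀).1]
    have := hg1 (q x₀)
    rw [hs₀] at this
    rw [this, mul_one]
  · have key : ∀ b ∈ t, ∀ᶠ y in 𝓝 x, ∀ p,
        φ b (q y) • α (g b y, p) = φ b (q y) • α (g b x, p) := by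
      intro b _
      by_cases hb : dist (q x) b < r b
      · filter_upwards [(hg b x hb).2] with y hy p
        rw [hy]
      · have : ∀ᶠ y in 𝓝 x, r b / 2 < dist (q y) b :=
          (hqc.dist continuous_const).continuousAt.eventually_const_lt (by linarith [hr b])
        filter_upwards [this] with y hy p
        rw [hφr b (q y) hy.le, zero_smul, zero_smul]
    filter_upwards [(Filter.eventually_all_finset t).2 key] with y hy p
    exact Finset.sum_congr rfl fun b hb => hy b hb p

end

theorem mainTheorem10
    {Γ : Type*} [Group Γ] (S : Finset Γ) (hS : Subgroup.closure (S : Set Γ) = ⊤)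
    -- the finite CW complex `BΓ` with a geodesic metric inducing its topology
    {B : Type*} [MetricSpace B] [Topology.CWComplex (Set.univ : Set B)]
    [Topology.CWComplex.Finite (Set.univ : Set B)] (hB : IsGeodesicSpace B)
    -- its universal cover `EΓ`, contractible, with `Γ` as the group of deck transformations
    {E : Type*} [TopologicalSpace E] [ContractibleSpace E] [MulAction Γ E]
    (q : E → B) (hq : IsQuotientCoveringMap q Γ)
    -- the finite-dimensional simplicial complex `P` with its `Γ`-action
    {V : Type*} [MulAction Γ V] (P : AbstractSimplicialComplex V) [SimplicialAction Γ P]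
    (hP : IsFiniteDimensionalComplex P)
    (n : ℕ) (α : Γ × Realization P → EuclideanSpace ℝ (Fin n))
    (h1 : IsDiagonallyInvariant Γ α)
    (h2 : IsProperOnSlices α)
    (h3 : ∀ (p : Realization P) (g h : Γ), dist (α (g, p)) (α (h, p)) ≤ (wordDist S g h : ℝ))
    -- the point of `EΓ` whose orbit is identified with `Γ`
    (x₀ : E) :
    ∃ αbar : E × Realization P → EuclideanSpace ℝ (Fin n),
      Continuous αbar ∧
      (∃ c : ℝ, 0 < c ∧ ∀ (g : Γ) (p : Realization P), αbar (g • x₀, p) = c • α (g, p)) ∧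
      IsDiagonallyInvariant Γ αbar ∧
      IsProperOnSlices αbar ∧
      (∀ (p : Realization P) (x y : E),
        edist (αbar (x, p)) (αbar (y, p)) ≤ liftedEDist q x y) := by
  have : CompactSpace B := Topology.CWComplex.compactSpace_of_finite
  obtain ⟨t, φ, A, hφL, hφ0, hφ1, hAinv, hAx₀, hA⟩ := hq.exists_local_combination h1 x₀
  obtain ⟨C, hC, hAC⟩ := hq.exists_uniform_of_locally hAinv fun x => by
    obtain ⟨k, hk⟩ := hA x
    choose L W hW hL using fun b => hφL b (q x)
    refine ⟨∑ b ∈ t, L b * wordDist S (k b) 1, _, Filter.inter_mem hk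
      ((Filter.biInter_finset_mem t).2 fun b _ => hq.continuous.continuousAt (hW b)),
      fun y hy z hz p => ?_⟩
    -- Subtracting `α (1, p)` is free because the weight differences sum to `0`; the remaining
    -- factors are bounded independently of `p`.
    have e : A (y, p) - A (z, p) =
        ∑ b ∈ t, (φ b (q y) - φ b (q z)) • (α (k b, p) - α (1, p)) := by
      have h0 : ∑ b ∈ t, (φ b (q y) - φ b (q z)) = 0 := by
        rw [Finset.sum_sub_distrib, hφ1, hφ1, sub_self]
      simp only [smul_sub]
      rw [Finset.sum_sub_distrib, ← Finset.sum_smul, h0, zero_smul, sub_zero, hy.1 p, hz.1 p,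
        ← Finset.sum_sub_distrib]
      simp only [sub_smul]
    rw [dist_eq_norm, e, Finset.sum_mul]
    refine norm_sum_le_of_le t fun b hb => ?_
    have hyb := Set.mem_iInter₂.1 hy.2 b hb
    have hzb := Set.mem_iInter₂.1 hz.2 b hb
    have hφb := (hL b).dist_le_mul _ hyb _ hzb
    rw [norm_smul, ← dist_eq_norm, ← dist_eq_norm, mul_right_comm]
    exact mul_le_mul hφb (h3 p _ _) dist_nonneg (by positivity)
  have hAcont : Continuous A := by
    refine continuous_iff_continuousAt.2 fun ⟨x, p⟩ => ?_
    obtain ⟨k, hk⟩ := hA x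
    have hc : Continuous fun z : E × Realization P =>
        ∑ b ∈ t, φ b (q z.1) • α (k b, z.2) :=
      continuous_finsetSum t fun b _ =>
        ((hφL b).continuous.comp (hq.continuous.comp continuous_fst)).smul
          ((h2 (k b)).continuous.comp continuous_snd)
    refine hc.continuousAt.congr ?_
    filter_upwards [continuous_fst.continuousAt.eventually hk] with z hz
    exact (hz z.2).symm
  have hAproper : IsProperOnSlices A := fun x => by
    obtain ⟨k, hk⟩ := hA x
    refine (h2 1).of_dist_le (C := ∑ b ∈ t, φ b (q x) * wordDist S (k b) 1)
      (hAcont.comp (Continuous.prodMk_right x)) fun p => ?_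
    -- Here the weights themselves sum to `1`, so the distance to `α (1, p)` is bounded uniformly in
    -- `p`.
    have e : A (x, p) - α (1, p) = ∑ b ∈ t, φ b (q x) • (α (k b, p) - α (1, p)) := by
      simp only [smul_sub]
      rw [Finset.sum_sub_distrib, ← Finset.sum_smul, hφ1, one_smul, hk.self_of_nhds p]
    rw [dist_eq_norm, e]
    refine norm_sum_le_of_le t fun b _ => ?_
    rw [norm_smul, Real.norm_of_nonneg (hφ0 _ _), ← dist_eq_norm]
    exact mul_le_mul_of_nonneg_left (h3 p _ _) (hφ0 _ _)
  refine ⟨fun z => C⁻¹ • A z, by fun_prop, ⟨C⁻¹, inv_pos.2 hC, fun g p => ?_⟩,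
    fun γ x p => ?_, fun x => ?_, fun p => edist_le_liftedEDist_of_locally fun x => ?_⟩
  · simp only [hAx₀]
  · simp only [hAinv γ x p]
  · exact (Homeomorph.smulOfNeZero C⁻¹ (inv_ne_zero hC.ne')).isProperMap.comp (hAproper x)
  · obtain ⟨W, hW, hle⟩ := hAC x
    refine ⟨W, hW, fun y hy z hz => ?_⟩
    rw [edist_dist, edist_dist, dist_smul₀, Real.norm_of_nonneg (inv_pos.2 hC).le]
    exact ENNReal.ofReal_le_ofReal ((inv_mul_le_iff₀ hC).2 (hle y hy z hz p))
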